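/- Let $G$ be a finite noncyclic group of order $n$, written multiplicatively, and let $p$ be the smallest prime divisor of $n$. A sequence over $G$ is a finite unordered sequence of elements of $G$ in which repetition is allowed (that is, a finite multiset of elements of $G$); its length is the number of its terms counted with multiplicity. A sequence is called one-product free if none of its nonempty subsequences has terms that can be ordered so that their product is $1$. Let $\mathsf d(G)$, the small Davenport constant of $G$, be the supremum of the lengths of the one-product free sequences over $G$. Then $\mathsf d(G)$ is finite and $$\mathsf d(G) \le \frac{n}{p} + 9p^2 - 10p.$$ -/

import Mathlib

/-- The set of products of a sequence `S` over `G` (a finite unordered sequence with repetition,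
i.e. a multiset): all products of the terms of `S`, each used exactly once, in some order. -/
def productSet {G : Type*} [Group G] (S : Multiset G) : Set G :=
  {g | ∃ l : List G, (l : Multiset G) = S ∧ l.prod = g}

/-- The set of all products of nonempty subsequences of `S`. -/
def subsequenceProducts {G : Type*} [Group G] (S : Multiset G) : Set G :=
  {g | ∃ T : Multiset G, T ≤ S ∧ T ≠ 0 ∧ g ∈ productSet T}

/-- `S` is one-product free: no nonempty subsequence of `S` can be ordered so that the product
of its terms is `1`. -/
def IsOneProductFree {G : Type*} [Group G] (S : Multiset G) : Prop :=
  1 ∉ subsequenceProducts S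

/-- The small Davenport constant of `G`, with values in `ℕ ∪ {∞}`: the supremum of the lengths
of the one-product free sequences over `G`. -/
noncomputable def smallDavenport (G : Type*) [Group G] : ℕ∞ :=
  ⨆ S : {S : Multiset G // IsOneProductFree S}, ((S : Multiset G).card : ℕ∞)

/-!
For a one-product free sequence `S` let `φ(S)` be the number of products of its nonempty
subsequences (`subproductCount`). Since `1` is not among them, `φ(S) ≤ n - 1`. It therefore suffices
to show `p |S| ≤ φ(S) + (p - 1) w` with a number `w` of wasted terms satisfying
`(p - 1) w ≤ p (9p² - 10p) + 1`. The basic tool is superadditivity, `φ(S + T) ≥ φ(S) + φ(T)`, which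
follows from the Kemperman–Scherk theorem (`card_add_card_le_card_mul_add_one`).

*Distinct terms.* If a set `A` of distinct terms is one-product free, then `φ(A)` grows
quadratically in `|A|` (`card_mul_sub_nine_le`), so a set of size `k = 9p + 9` already has
`φ(A) ≥ p |A|`; for `p = 2`, where involutions weaken the estimate, `k = 33` is used instead. The
growth comes from an argument of Olson: if the remaining elements generate a group in which the
current set `B` of subproducts and its complement are not too small, some remaining `a` satisfies
`|B ∪ Ba| ≥ |B| + min (|B| / 2) (|E| / 4)`, where `E` consists of `1` and the remaining elements
and their inverses. If the remaining elements do not generate, many elements of `A` lie in a proper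
subgroup, and the few outside multiply the number of subproducts by the number of cosets they reach.

*Repeated terms.* Let `H` be a subgroup. The products of `p - 1` terms outside `H` meet at least `p`
cosets of `H` (`min_le_card_image_subproducts`), so that each term in `H` then counts `p` times.
Split sets of size `k` off `S` until the rest `T` has fewer than `k` distinct terms. Terms of
multiplicity less than `p` in `T` are few. If the terms of multiplicity at least `p` generate several
maximal cyclic subgroups, these can help each other in a cycle (`mul_card_le_or_forall_mem`).
Otherwise they lie in one cyclic subgroup `H`, which is proper because `G` is not cyclic. Then either
`S` has at most `p - 2` terms outside `H`, and `|S| ≤ |H| - 1 + p - 2 ≤ n / p + p - 3`, or `p - 1`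
terms outside `H` are available after putting some of the sets back into `T`
(`mul_card_le_of_card_filter_lt`).
-/

/-! ### Sumset estimates in finite groups -/

section Additive

open scoped Pointwise
open Finset

variable {G : Type*} [Group G] [DecidableEq G]

/-- Right translation by `x` enlarges `A` by as many elements as it moves out of `A`. -/
theorem card_union_mul_singleton_add (A : Finset G) (x : G) :
    #(A ∪ A * {x}) + #{a ∈ A | a * x ∈ A} = 2 * #A := by
  have h : #{a ∈ A | a * x ∈ A} = #(A ∩ (A * {x})) := by
    rw [← card_mul_singleton {a ∈ A | a * x ∈ A} x]
    congr 1
    ext y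
    simp only [mem_mul, mem_filter, mem_singleton, mem_inter]
    constructor
    · rintro ⟨a, ⟨ha, hax⟩, _, rfl, rfl⟩
      exact ⟨hax, a, ha, _, rfl, rfl⟩
    · rintro ⟨hy, a, ha, _, rfl, rfl⟩
      exact ⟨a, ⟨ha, hy⟩, _, rfl, rfl⟩
  rw [h, card_union_add_card_inter, card_mul_singleton]
  ring

theorem card_union_singleton_mul_add (B : Finset G) (x : G) :
    #(B ∪ {x} * B) + #{b ∈ B | x * b ∈ B} = 2 * #B := by
  have h : #{b ∈ B | x * b ∈ B} = #(B ∩ ({x} * B)) := by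
    rw [← card_singleton_mul x {b ∈ B | x * b ∈ B}]
    congr 1
    ext y
    simp only [mem_mul, mem_filter, mem_singleton, mem_inter]
    constructor
    · rintro ⟨_, rfl, b, ⟨hb, hxb⟩, rfl⟩
      exact ⟨hxb, _, rfl, b, hb, rfl⟩
    · rintro ⟨hy, _, rfl, b, hb, rfl⟩
      exact ⟨_, rfl, b, ⟨hb, hy⟩, rfl⟩
  rw [h, card_union_add_card_inter, card_singleton_mul]
  ring

/-- Kemperman's form of the Kemperman–Scherk theorem, in a possibly nonabelian finite group: if `1` is
only the product `1 * 1`, then `|AB| ≥ |A| + |B| - 1`. For `x ≠ 1` in `A ∩ B` the pairs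
`(A ∪ Ax, B ∩ x⁻¹B)` and `(A ∩ Ax⁻¹, B ∪ xB)` satisfy the same hypotheses and their products lie in
`AB`; one of the two either increases `|A| + |B|`, or preserves it and shrinks `B`. Once
`A ∩ B = {1}`, the union `A ∪ B ⊆ AB` suffices. -/
theorem card_add_card_le_card_mul_add_one [Fintype G] (A B : Finset G) (hA : 1 ∈ A) (hB : 1 ∈ B)
    (h : ∀ a ∈ A, ∀ b ∈ B, a * b = 1 → a = 1) : #A + #B ≤ #(A * B) + 1 := by
  by_cases hx : ∃ x ∈ A ∩ B, x ≠ 1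
  · obtain ⟨x, hxAB, hx1⟩ := hx
    obtain ⟨hxA, hxB⟩ := mem_inter.1 hxAB
    have h1 := card_union_mul_singleton_add A x
    have h2 := card_union_singleton_mul_add B x
    have hBlt : #{b ∈ B | x * b ∈ B} < #B := by
      refine card_lt_card ((filter_ssubset).2 ?_)
      by_contra! hcon
      -- left multiplication by `x` maps `B` into, hence onto, `B`, so `x⁻¹ ∈ B`
      have hsub : {x} * B ⊆ B := by
        intro y hy
        obtain ⟨_, hx', b, hb, rfl⟩ := mem_mul.1 hy
        rw [mem_singleton.1 hx']
        exact hcon b hb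
      have heq : {x} * B = B := eq_of_subset_of_card_le hsub (by rw [card_singleton_mul])
      rw [← heq] at hB
      obtain ⟨_, hx', b, hb, hxb⟩ := mem_mul.1 hB
      rw [mem_singleton.1 hx'] at hxb
      exact hx1 (h x hxA b hb hxb)
    have hbound : #A + #B ≤ 2 * Fintype.card G := by
      have := card_le_univ A
      have := card_le_univ B
      omega
    by_cases hc : #B ≤ #{b ∈ B | x * b ∈ B} + (#(A ∪ A * {x}) - #A)
    · have hsub : (A ∪ A * {x}) * {b ∈ B | x * b ∈ B} ⊆ A * B := by
        intro y hy
        obtain ⟨a, ha, b, hb, rfl⟩ := mem_mul.1 hy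
        obtain ⟨hb, hxb⟩ := mem_filter.1 hb
        rcases mem_union.1 ha with ha | ha
        · exact mul_mem_mul ha hb
        · obtain ⟨a', ha', _, hx', rfl⟩ := mem_mul.1 ha
          rw [mem_singleton.1 hx', mul_assoc]
          exact mul_mem_mul ha' hxb
      have hle : #A ≤ #(A ∪ A * {x}) := card_le_card subset_union_left
      have ih := card_add_card_le_card_mul_add_one (A ∪ A * {x}) {b ∈ B | x * b ∈ B}
        (mem_union_left _ hA) (by simp [hB, hxB]) (by
          intro a ha b hb hab
          obtain ⟨hb, hxb⟩ := mem_filter.1 hb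
          rcases mem_union.1 ha with ha | ha
          · exact h a ha b hb hab
          · obtain ⟨a', ha', _, hx', rfl⟩ := mem_mul.1 ha
            rw [mem_singleton.1 hx'] at hab ⊢
            have ha1 := h a' ha' _ hxb (by rw [← mul_assoc, hab])
            subst ha1
            rw [one_mul] at hab
            exact absurd (h x hxA b hb hab) hx1)
      have := card_le_card hsub
      omega
    · have hsub : {a ∈ A | a * x ∈ A} * (B ∪ {x} * B) ⊆ A * B := by
        intro y hy
        obtain ⟨a, ha, b, hb, rfl⟩ := mem_mul.1 hy
        obtain ⟨ha, hax⟩ := mem_filter.1 ha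
        rcases mem_union.1 hb with hb | hb
        · exact mul_mem_mul ha hb
        · obtain ⟨_, hx', b', hb', rfl⟩ := mem_mul.1 hb
          rw [mem_singleton.1 hx', ← mul_assoc]
          exact mul_mem_mul hax hb'
      have hle : #A ≤ #(A ∪ A * {x}) := card_le_card subset_union_left
      have ih := card_add_card_le_card_mul_add_one {a ∈ A | a * x ∈ A} (B ∪ {x} * B)
        (by simp [hA, hxA]) (mem_union_left _ hB) (by
          intro a ha b hb hab
          obtain ⟨ha, hax⟩ := mem_filter.1 ha
          rcases mem_union.1 hb with hb | hb
          · exact h a ha b hb hab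
          · obtain ⟨_, hx', b', hb', rfl⟩ := mem_mul.1 hb
            rw [mem_singleton.1 hx'] at hab
            have ha1 := h _ hax b' hb' (by rw [mul_assoc, hab])
            exact h a ha x hxB ha1)
      have := card_le_card hsub
      omega
  · push Not at hx
    have hi : A ∩ B = {1} := by
      ext y
      simp only [mem_singleton]
      exact ⟨hx y, by rintro rfl; exact mem_inter.2 ⟨hA, hB⟩⟩
    have hsub : A ∪ B ⊆ A * B := by
      intro y hy
      rcases mem_union.1 hy with hy | hy
      · simpa using mul_mem_mul hy hB
      · simpa using mul_mem_mul hA hy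
    have h1 := card_union_add_card_inter A B
    rw [hi, card_singleton] at h1
    have := card_le_card hsub
    omega
termination_by (2 * Fintype.card G - (#A + #B), #B)
decreasing_by
  · have hub : #(A ∪ A * {x}) + #{b ∈ B | x * b ∈ B} ≤ 2 * Fintype.card G := by
      have := card_le_univ (A ∪ A * {x})
      have := card_le_univ {b ∈ B | x * b ∈ B}
      omega
    rw [Prod.lex_def]
    simp only
    omega
  · have hub : #{a ∈ A | a * x ∈ A} + #(B ∪ {x} * B) ≤ 2 * Fintype.card G := by
      have := card_le_univ (B ∪ {x} * B)
      have := card_le_univ {a ∈ A | a * x ∈ A}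
      omega
    rw [Prod.lex_def]
    simp only
    omega

/-- Isoperimetric inequality for a symmetric set `E` containing `1` that generates the subgroup with
underlying set `H`: `|XE| ≥ |X| + |E| / 2` unless `XE = H`. This is Hamidoune's atom argument: a
smallest set among those minimizing `|XE| - |X|` is, up to translation, a subgroup, and for
subgroups the inequality is immediate. -/
theorem two_mul_card_add_card_le_of_mul_ne (E H : Finset G) (h1 : 1 ∈ E)
    (hinv : ∀ x ∈ E, x⁻¹ ∈ E) (hH : ∀ x, x ∈ H ↔ x ∈ Subgroup.closure (E : Set G))
    (X : Finset G) (hX : X.Nonempty) (hXH : X ⊆ H) (hne : X * E ≠ H) :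
    2 * #X + #E ≤ 2 * #(X * E) := by
  classical
  have hEH : E ⊆ H := fun x hx => (hH x).2 (Subgroup.subset_closure hx)
  have hmulH : ∀ {a b}, a ∈ H → b ∈ H → a * b ∈ H := fun ha hb =>
    (hH _).2 (mul_mem ((hH _).1 ha) ((hH _).1 hb))
  have hinvH : ∀ {a}, a ∈ H → a⁻¹ ∈ H := fun ha => (hH _).2 (inv_mem ((hH _).1 ha))
  have hYE : ∀ {Y : Finset G}, Y ⊆ H → Y * E ⊆ H := fun hY z hz => by
    obtain ⟨y, hy, e, he, rfl⟩ := mem_mul.1 hz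
    exact hmulH (hY hy) (hEH he)
  have hsubE : ∀ Y : Finset G, Y ⊆ Y * E := fun Y y hy => by simpa using mul_mem_mul hy h1
  have hcardE : ∀ Y : Finset G, #Y ≤ #(Y * E) := fun Y => card_le_card (hsubE Y)
  -- fragments are ordered by boundary size first, by cardinality second
  let F : Finset (Finset G) := {Y ∈ H.powerset | Y.Nonempty ∧ Y * E ≠ H}
  have hF : ∀ Y, Y ∈ F ↔ Y ⊆ H ∧ Y.Nonempty ∧ Y * E ≠ H := by simp [F]
  let f : Finset G → ℕ := fun Y => (#(Y * E) - #Y) * (#H + 1) + #Y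
  obtain ⟨A₀, hA₀F, hA₀⟩ := exists_min_image F f ⟨X, (hF X).2 ⟨hXH, hX, hne⟩⟩
  -- a left translate of the minimal fragment contains `1`
  have htrans : ∀ g ∈ H, ∀ Y ∈ F, g • Y ∈ F ∧ #(g • Y) = #Y ∧ #(g • Y * E) = #(Y * E) := by
    intro g hg Y hY
    obtain ⟨hYH, hYn, hYne⟩ := (hF Y).1 hY
    refine ⟨(hF _).2 ⟨?_, hYn.smul_finset, ?_⟩, card_smul_finset g Y, ?_⟩
    · intro z hz
      obtain ⟨y, hy, rfl⟩ := mem_smul_finset.1 hz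
      exact hmulH hg (hYH hy)
    · intro hcon
      apply hYne
      apply eq_of_subset_of_card_le (hYE hYH)
      rw [← hcon, smul_mul_assoc, card_smul_finset]
    · rw [smul_mul_assoc, card_smul_finset]
  obtain ⟨A, hAF, hAmin, h1A⟩ : ∃ A ∈ F, (∀ Y ∈ F, f A ≤ f Y) ∧ 1 ∈ A := by
    obtain ⟨a, ha⟩ := ((hF A₀).1 hA₀F).2.1
    obtain ⟨t1, t2, t3⟩ := htrans a⁻¹ (hinvH (((hF A₀).1 hA₀F).1 ha)) A₀ hA₀F
    refine ⟨a⁻¹ • A₀, t1, fun Y hY => ?_, mem_smul_finset.2 ⟨a, ha, by simp⟩⟩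
    simp only [f, t2, t3]
    exact hA₀ Y hY
  obtain ⟨hAH, hAn, hAne⟩ := (hF A).1 hAF
  have hbd : ∀ Y ∈ F, #(A * E) + #Y ≤ #(Y * E) + #A := by
    intro Y hY
    have hle := hAmin Y hY
    have hYH := card_le_card ((hF Y).1 hY).1
    have := hcardE A
    have := hcardE Y
    by_contra! hlt
    have hlt' : #(Y * E) - #Y + 1 ≤ #(A * E) - #A := by omega
    have := Nat.mul_le_mul_right (#H + 1) hlt'
    simp only [f] at hle
    rw [add_mul] at this
    omega
  have hcd : ∀ Y ∈ F, #(A * E) + #Y = #(Y * E) + #A → #A ≤ #Y := by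
    intro Y hY heq
    have hle := hAmin Y hY
    have := hcardE A
    have := hcardE Y
    have : #(Y * E) - #Y = #(A * E) - #A := by omega
    simp only [f, this] at hle
    omega
  -- two minimal fragments that meet coincide
  have hatom : ∀ Y ∈ F, #Y = #A → #(Y * E) = #(A * E) → (A ∩ Y).Nonempty → A = Y := by
    intro Y hYF hc1 hc2 hI
    by_contra hAY
    have hIlt : #(A ∩ Y) < #A := by
      refine card_lt_card ⟨inter_subset_left, fun hcon => hAY ?_⟩
      exact eq_of_subset_of_card_le (hcon.trans inter_subset_right) hc1.le
    have hIF : A ∩ Y ∈ F := by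
      refine (hF _).2 ⟨inter_subset_left.trans hAH, hI, fun hcon => hAne ?_⟩
      refine (hYE hAH).antisymm ?_
      rw [← hcon]
      exact mul_subset_mul_right inter_subset_left
    have hIbd : #(A * E) + #(A ∩ Y) < #((A ∩ Y) * E) + #A := by
      refine lt_of_le_of_ne (hbd _ hIF) fun hcon => ?_
      have := hcd _ hIF hcon
      omega
    have hI2 : #((A ∩ Y) * E) ≤ #(A * E ∩ (Y * E)) := card_le_card inter_mul_subset
    have hU2 := card_union_add_card_inter (A * E) (Y * E)
    rw [← union_mul] at hU2
    have hU3 := card_union_add_card_inter A Y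
    have hI1 : 0 < #(A ∩ Y) := hI.card_pos
    by_cases hU : (A ∪ Y) * E = H
    · -- the complement of `A * E` is a fragment too
      have hZ : H \ (A * E) ∈ F := by
        refine (hF _).2 ⟨sdiff_subset, ?_, fun hcon => ?_⟩
        · rw [sdiff_nonempty]
          exact fun hcon => hAne ((hYE hAH).antisymm hcon)
        · have h1' : (1 : G) ∈ (H \ (A * E)) * E := by rw [hcon]; exact hAH h1A
          obtain ⟨z, hz, e, he, hze⟩ := mem_mul.1 h1'
          refine (mem_sdiff.1 hz).2 ?_
          rw [eq_inv_of_mul_eq_one_left hze]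
          simpa using mul_mem_mul h1A (hinv e he)
      have hZE : (H \ (A * E)) * E ⊆ H \ A := by
        intro w hw
        obtain ⟨z, hz, e, he, rfl⟩ := mem_mul.1 hw
        refine mem_sdiff.2 ⟨hmulH (mem_sdiff.1 hz).1 (hEH he), fun hcon => (mem_sdiff.1 hz).2 ?_⟩
        simpa using mul_mem_mul hcon (hinv e he)
      have c1 := card_le_card hZE
      rw [card_sdiff_of_subset hAH] at c1
      have c2 := card_sdiff_of_subset (hYE hAH)
      have c3 := card_le_card (hYE hAH)
      have c4 := hcardE A
      have c5 := hbd _ hZ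
      have c6 := hcd _ hZ (by omega)
      rw [hU] at hU2
      omega
    · have hUF : A ∪ Y ∈ F :=
        (hF _).2 ⟨union_subset hAH ((hF Y).1 hYF).1, hAn.mono subset_union_left, hU⟩
      have := hbd _ hUF
      omega
  -- hence the minimal fragment through `1` is a subgroup
  have hclosed : ∀ g ∈ A, ∀ h ∈ A, g⁻¹ * h ∈ A := by
    intro g hg h hh
    obtain ⟨t1, t2, t3⟩ := htrans g⁻¹ (hinvH (hAH hg)) A hAF
    have heq := hatom _ t1 t2 t3 ⟨1, mem_inter.2 ⟨h1A, mem_smul_finset.2 ⟨g, hg, by simp⟩⟩⟩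
    rw [heq]
    exact mem_smul_finset.2 ⟨h, hh, rfl⟩
  let K : Subgroup G :=
    { carrier := A
      one_mem' := h1A
      inv_mem' := fun {x} hx => by simpa using hclosed x hx 1 h1A
      mul_mem' := fun {x y} hx hy => by
        simpa using hclosed x⁻¹ (by simpa using hclosed x hx 1 h1A) y hy }
  obtain ⟨x, hxE, hxA⟩ : ∃ x ∈ E, x ∉ A := by
    by_contra! hcon
    have hle : Subgroup.closure (E : Set G) ≤ K := (Subgroup.closure_le K).2 hcon
    exact hAne ((hYE hAH).antisymm (fun y hy => hsubE A (hle ((hH y).1 hy))))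
  have hdisj : Disjoint A (A * {x}) := by
    rw [disjoint_left]
    intro a ha hax
    obtain ⟨b, hb, _, hx', rfl⟩ := mem_mul.1 hax
    rw [mem_singleton.1 hx'] at ha
    exact hxA (by simpa using hclosed b hb _ ha)
  have c1 : #A + #A ≤ #(A * E) := by
    calc #A + #A = #(A ∪ A * {x}) := by rw [card_union_of_disjoint hdisj, card_mul_singleton]
      _ ≤ #(A * E) := card_le_card (union_subset (hsubE A)
          (mul_subset_mul_left (singleton_subset_iff.2 hxE)))
  have c2 : #E ≤ #(A * E) := card_le_card (fun e he => by simpa using mul_mem_mul h1A he)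
  have := hbd X ((hF X).2 ⟨hXH, hX, hne⟩)
  omega

theorem pow_subset_of_mem_iff_mem_closure (E H : Finset G)
    (hH : ∀ x, x ∈ H ↔ x ∈ Subgroup.closure (E : Set G)) (j : ℕ) : E ^ j ⊆ H := by
  induction j with
  | zero => simpa using (hH 1).2 (one_mem _)
  | succ j ih =>
    rw [pow_succ]
    intro z hz
    obtain ⟨y, hy, e, he, rfl⟩ := mem_mul.1 hz
    exact (hH _).2 (mul_mem ((hH _).1 (ih hy)) (Subgroup.subset_closure he))

theorem le_two_mul_card_pow (E H : Finset G) (h1 : 1 ∈ E) (hinv : ∀ x ∈ E, x⁻¹ ∈ E)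
    (hH : ∀ x, x ∈ H ↔ x ∈ Subgroup.closure (E : Set G)) (j : ℕ) (hj : 1 ≤ j) :
    (j + 1) * #E ≤ 2 * #(E ^ j) ∨ E ^ j = H := by
  have hpowH := pow_subset_of_mem_iff_mem_closure E H hH
  induction j, hj using Nat.le_induction with
  | base => left; simp
  | succ j hj ih =>
    by_cases hne : E ^ (j + 1) = H
    · exact Or.inr hne
    · left
      rw [pow_succ] at hne ⊢
      rcases ih with ih | ih
      · have := two_mul_card_add_card_le_of_mul_ne E H h1 hinv hH (E ^ j)
          ⟨1, one_mem_pow h1⟩ (hpowH j) hne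
        linarith
      · exfalso
        refine hne ((?_ : E ^ j * E ⊆ H).antisymm fun y hy => ?_)
        · rw [← pow_succ]; exact hpowH _
        · rw [← ih] at hy
          simpa using mul_mem_mul hy h1

/-- The number of elements of `Dx` outside `D` is subadditive in `x`. -/
theorem card_mul_singleton_sdiff_mul_le (D : Finset G) (x y : G) :
    #((D * {x * y}) \ D) ≤ #((D * {x}) \ D) + #((D * {y}) \ D) := by
  have hsub : (D * {x * y}) \ D ⊆ ((D * {x}) \ D) * {y} ∪ (D * {y}) \ D := by
    intro z hz
    obtain ⟨hz, hzD⟩ := mem_sdiff.1 hz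
    obtain ⟨d, hd, _, hxy, rfl⟩ := mem_mul.1 hz
    rw [mem_singleton.1 hxy, ← mul_assoc] at hzD ⊢
    by_cases hdx : d * x ∈ D
    · exact mem_union_right _ (mem_sdiff.2 ⟨mul_mem_mul hdx (mem_singleton_self y), hzD⟩)
    · exact mem_union_left _ (mul_mem_mul
        (mem_sdiff.2 ⟨mul_mem_mul hd (mem_singleton_self x), hdx⟩) (mem_singleton_self y))
  calc _ ≤ _ := card_le_card hsub
    _ ≤ _ := card_union_le _ _
    _ = _ := by rw [card_mul_singleton]

/-- Each pair of elements of `D` is `(d, dx)` for only one `x`. -/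
theorem sum_card_mul_singleton_inter_le (D Y : Finset G) :
    ∑ x ∈ Y, #((D * {x}) ∩ D) ≤ #D * #D := by
  rw [← card_sigma, ← card_product]
  refine card_le_card_of_injOn (fun q => (q.2 * q.1⁻¹, q.2)) ?_ ?_
  · rintro ⟨x, z⟩ hq
    simp only [coe_sigma, Set.mem_sigma_iff, mem_coe, mem_inter] at hq
    obtain ⟨-, hz, hzD⟩ := hq
    obtain ⟨d, hd, _, hx, rfl⟩ := mem_mul.1 hz
    rw [mem_singleton.1 hx] at hzD ⊢
    simp [hd, hzD]
  · rintro ⟨x, z⟩ - ⟨x', z'⟩ - hq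
    simp only [Prod.mk.injEq] at hq
    obtain ⟨h1, rfl⟩ := hq
    simpa using h1

/-- Olson's growth lemma: if `|D|` is at most half the order of the group generated by `E`, then some
`x ∈ E` satisfies `|Dx \ D| ≥ min (|D| / 2) (|E| / 4)`. When `2|D| ≤ |E|`, average over `E`.
Otherwise average over `2|D|` elements that are short words in `E`; by the isoperimetric inequality
more than `u` elements have length at most `(2u + 1) / |E|`, which bounds the total displacement
of `u` well-chosen elements by `L u ^ 2 / |E|`. -/
theorem card_le_or_card_le_of_forall_card_mul_singleton_sdiff_le (E H : Finset G) (h1 : 1 ∈ E)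
    (hinv : ∀ x ∈ E, x⁻¹ ∈ E) (hH : ∀ x, x ∈ H ↔ x ∈ Subgroup.closure (E : Set G))
    (D : Finset G) (hD : D.Nonempty) (hDH : 2 * #D ≤ #H) (L : ℕ)
    (hL : ∀ x ∈ E, #((D * {x}) \ D) ≤ L) : #D ≤ 2 * L ∨ #E ≤ 4 * L := by
  have havg : ∀ Y : Finset G, #Y * #D ≤ ∑ x ∈ Y, #((D * {x}) \ D) + #D * #D := by
    intro Y
    have h := sum_card_mul_singleton_inter_le D Y
    have h' : ∑ x ∈ Y, (#((D * {x}) ∩ D) + #((D * {x}) \ D)) = #Y * #D := by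
      simp [card_inter_add_card_sdiff]
    rw [sum_add_distrib] at h'
    omega
  have hDpos := hD.card_pos
  by_cases hc : 2 * #D ≤ #E
  · left
    have h := havg E
    have h' : ∑ x ∈ E, #((D * {x}) \ D) ≤ #E * L := by
      simpa using sum_le_card_nsmul E _ L hL
    by_contra! hlt
    nlinarith [Nat.mul_le_mul_left #E (show 2 * L + 1 ≤ #D by omega), Nat.mul_le_mul_right #D hc]
  · right
    push Not at hc
    have hpow : ∀ j, ∀ x ∈ E ^ j, #((D * {x}) \ D) ≤ j * L := by
      intro j
      induction j with
      | zero =>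
        intro x hx
        rw [pow_zero, mem_one] at hx
        subst hx
        have : D * {(1 : G)} = D := by rw [singleton_one, mul_one]
        simp [this]
      | succ j ih =>
        intro x hx
        rw [pow_succ] at hx
        obtain ⟨y, hy, e, he, rfl⟩ := mem_mul.1 hx
        have h2 := card_mul_singleton_sdiff_mul_le D y e
        have h3 := ih y hy
        have h4 := hL e he
        linarith
    have hEH : E ⊆ H := fun x hx => (hH x).2 (Subgroup.subset_closure hx)
    -- `Y` collects elements of `H` that are short words in `E`
    have hY : ∀ u, #E ≤ u → u ≤ #H → ∃ Y ⊆ H, #Y = u ∧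
        #E * ∑ x ∈ Y, #((D * {x}) \ D) ≤ L * u ^ 2 := by
      intro u hu
      induction u, hu using Nat.le_induction with
      | base =>
        intro _
        refine ⟨E, hEH, rfl, ?_⟩
        have h' : ∑ x ∈ E, #((D * {x}) \ D) ≤ #E * L := by
          simpa using sum_le_card_nsmul E _ L hL
        calc _ ≤ #E * (#E * L) := Nat.mul_le_mul_left _ h'
          _ = _ := by ring
      | succ u hu ih =>
        intro hu'
        obtain ⟨Y, hYH, hYc, hYs⟩ := ih (by omega)
        have hEpos : 0 < #E := card_pos.2 ⟨1, h1⟩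
        -- more than `u` elements are words of length `j`, and `2 * u + 1` is the increment of `u ^ 2`
        set j := (2 * u + 1) / #E
        have hj1 : j * #E ≤ 2 * u + 1 := Nat.div_mul_le_self _ _
        have hj2 : 2 * u + 1 < (j + 1) * #E := by
          rw [add_mul, one_mul]; exact Nat.lt_div_mul_add hEpos
        have hj3 : 1 ≤ j := (Nat.one_le_div_iff hEpos).2 (by omega)
        have hlarge : #Y < #(E ^ j) := by
          rcases le_two_mul_card_pow E H h1 hinv hH j hj3 with h | h
          · omega
          · rw [h]; omega
        have hpowH := pow_subset_of_mem_iff_mem_closure E H hH j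
        obtain ⟨z, hz, hzY⟩ := exists_mem_notMem_of_card_lt_card hlarge
        refine ⟨insert z Y, insert_subset (hpowH hz) hYH, by rw [card_insert_of_notMem hzY, hYc], ?_⟩
        rw [sum_insert hzY, mul_add]
        have h5 := Nat.mul_le_mul_left #E (hpow j z hz)
        have h6 := Nat.mul_le_mul_right L hj1
        nlinarith
    obtain ⟨Y, -, hYc, hYs⟩ := hY (2 * #D) hc.le hDH
    have h := havg Y
    rw [hYc] at h
    have h7 : #D * #D ≤ ∑ x ∈ Y, #((D * {x}) \ D) := by nlinarith
    have h8 : #E * (#D * #D) ≤ 4 * L * (#D * #D) := by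
      calc _ ≤ _ := Nat.mul_le_mul_left _ h7
        _ ≤ _ := hYs
        _ = _ := by ring
    exact Nat.le_of_mul_le_mul_right h8 (by positivity)

end Additive

/-! ### Subproducts of one-product free sequences -/

section Subproducts

open scoped Pointwise
open Finset

variable {G : Type*} [Group G]

theorem IsOneProductFree.eq_nil {S : Multiset G} (hS : IsOneProductFree S) {l : List G}
    (hl : (l : Multiset G) ≤ S) (h : l.prod = 1) : l = [] := by
  by_contra hne
  exact hS ⟨l, hl, by simpa using hne, l, rfl, h⟩

theorem IsOneProductFree.mono {S T : Multiset G} (hT : IsOneProductFree T) (h : S ≤ T) :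
    IsOneProductFree S := by
  rintro ⟨U, hU, hU0, hprod⟩
  exact hT ⟨U, hU.trans h, hU0, hprod⟩

theorem IsOneProductFree.ne_one {S : Multiset G} (hS : IsOneProductFree S) {a : G} (ha : a ∈ S) :
    a ≠ 1 := by
  rintro rfl
  have := hS.eq_nil (l := [1]) (by simpa using ha) (by simp)
  simp at this

variable [Finite G]

/-- The products of the (possibly empty) subsequences of `S`, in all orders. Unlike
`subsequenceProducts S` it always contains `1`, and it is a `Finset`, the group being finite. -/
noncomputable def subproducts (S : Multiset G) : Finset G :=
  (Set.toFinite {g | ∃ l : List G, (l : Multiset G) ≤ S ∧ l.prod = g}).toFinset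

/-- The number of nonidentity elements of `subproducts S`. If `S` is one-product free, this is the
number of products of nonempty subsequences of `S`. -/
noncomputable def subproductCount (S : Multiset G) : ℕ := #(subproducts S) - 1

theorem mem_subproducts {S : Multiset G} {g : G} :
    g ∈ subproducts S ↔ ∃ l : List G, (l : Multiset G) ≤ S ∧ l.prod = g := by
  simp [subproducts]

theorem one_mem_subproducts (S : Multiset G) : 1 ∈ subproducts S :=
  mem_subproducts.2 ⟨[], by simp, by simp⟩

theorem card_subproducts (S : Multiset G) : #(subproducts S) = subproductCount S + 1 := by
  have : 0 < #(subproducts S) := card_pos.2 ⟨1, one_mem_subproducts S⟩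
  rw [subproductCount]
  omega

theorem subproducts_mono {S T : Multiset G} (h : S ≤ T) : subproducts S ⊆ subproducts T :=
  fun g hg => by
    obtain ⟨l, hl, rfl⟩ := mem_subproducts.1 hg
    exact mem_subproducts.2 ⟨l, hl.trans h, rfl⟩

theorem subproductCount_mono {S T : Multiset G} (h : S ≤ T) :
    subproductCount S ≤ subproductCount T :=
  Nat.sub_le_sub_right (card_le_card (subproducts_mono h)) 1

theorem mul_mem_subproducts {S T : Multiset G} {a b : G} (ha : a ∈ subproducts S)
    (hb : b ∈ subproducts T) : a * b ∈ subproducts (S + T) := by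
  obtain ⟨l, hl, rfl⟩ := mem_subproducts.1 ha
  obtain ⟨m, hm, rfl⟩ := mem_subproducts.1 hb
  refine mem_subproducts.2 ⟨l ++ m, ?_, by simp⟩
  rw [← Multiset.coe_add]
  exact add_le_add hl hm

theorem mem_subproducts_singleton (a : G) : a ∈ subproducts {a} :=
  mem_subproducts.2 ⟨[a], by simp, by simp⟩

theorem mem_of_mem_subproducts {S : Multiset G} {K : Subgroup G} (hS : ∀ x ∈ S, x ∈ K) {g : G}
    (hg : g ∈ subproducts S) : g ∈ K := by
  obtain ⟨l, hl, rfl⟩ := mem_subproducts.1 hg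
  exact list_prod_mem fun x hx => hS x (Multiset.mem_of_le hl (by simpa using hx))

theorem IsOneProductFree.eq_one_of_mul_eq_one {S T : Multiset G} (h : IsOneProductFree (S + T))
    {a b : G} (ha : a ∈ subproducts S) (hb : b ∈ subproducts T) (hab : a * b = 1) : a = 1 := by
  obtain ⟨l, hl, rfl⟩ := mem_subproducts.1 ha
  obtain ⟨m, hm, rfl⟩ := mem_subproducts.1 hb
  have := h.eq_nil (l := l ++ m) (by rw [← Multiset.coe_add]; exact add_le_add hl hm)
    (by simpa using hab)
  simp [(List.append_eq_nil_iff.1 this).1]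

/-- Superadditivity of the number of subproducts on one-product free sequences, from the
Kemperman–Scherk theorem. -/
theorem subproductCount_add_le {S T : Multiset G} (h : IsOneProductFree (S + T)) :
    subproductCount S + subproductCount T ≤ subproductCount (S + T) := by
  classical
  have := Fintype.ofFinite G
  have h1 := card_add_card_le_card_mul_add_one (subproducts S) (subproducts T)
    (one_mem_subproducts S) (one_mem_subproducts T)
    (fun a ha b hb hab => h.eq_one_of_mul_eq_one ha hb hab)
  have h2 : #(subproducts S * subproducts T) ≤ #(subproducts (S + T)) :=
    card_le_card fun g hg => by
      obtain ⟨a, ha, b, hb, rfl⟩ := mem_mul.1 hg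
      exact mul_mem_subproducts ha hb
  simp only [card_subproducts] at h1 h2
  omega

theorem one_le_subproductCount_singleton {a : G} (ha : a ≠ 1) : 1 ≤ subproductCount {a} := by
  have : 1 < #(subproducts {a}) :=
    one_lt_card.2 ⟨a, mem_subproducts_singleton a, 1, one_mem_subproducts _, ha⟩
  rw [card_subproducts] at this
  omega

theorem card_le_subproductCount {S : Multiset G} (hS : IsOneProductFree S) :
    S.card ≤ subproductCount S := by
  induction S using Multiset.induction_on with
  | empty => simp
  | cons a S ih =>
    rw [← Multiset.singleton_add] at hS ⊢
    have h1 := subproductCount_add_le hS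
    have h2 := one_le_subproductCount_singleton (hS.ne_one (a := a) (by simp))
    have h3 := ih (hS.mono (Multiset.le_add_left _ _))
    rw [Multiset.card_add, Multiset.card_singleton]
    omega

theorem subproductCount_lt_card {S : Multiset G} {K : Subgroup G} (hS : ∀ x ∈ S, x ∈ K) :
    subproductCount S < Nat.card K := by
  have h : #(subproducts S) ≤ Nat.card K := by
    rw [← Set.ncard_coe_finset, ← SetLike.coe_sort_coe, Nat.card_coe_set_eq]
    exact Set.ncard_le_ncard (fun g hg => mem_of_mem_subproducts hS hg) (Set.toFinite _)
  rw [card_subproducts] at h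
  omega

/-- The subproducts of `k` elements outside `H` meet at least `min p (k + 1)` left cosets of `H`: an
element `h ∉ H` either produces a new coset, or the cosets met so far contain an orbit of
`⟨h⟩` of size greater than `1`, hence of size at least the smallest prime divisor of `|G|`. -/
theorem min_le_card_image_subproducts [DecidableEq G] (H : Subgroup G) [DecidableEq (G ⧸ H)]
    (p : ℕ) (hp : ∀ d, d ∣ Nat.card G → d ≠ 1 → p ≤ d) (M : Multiset G) (hM : ∀ x ∈ M, x ∉ H) :
    min p (M.card + 1) ≤ #((subproducts M).image (QuotientGroup.mk : G → G ⧸ H)) := by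
  induction M using Multiset.induction_on with
  | empty =>
    refine (min_le_right _ _).trans ?_
    exact card_pos.2 ⟨_, mem_image_of_mem _ (one_mem_subproducts 0)⟩
  | cons h M ih =>
    have hM' := ih fun x hx => hM x (Multiset.mem_cons_of_mem hx)
    set Y := (subproducts M).image (QuotientGroup.mk : G → G ⧸ H) with hY
    set Z := (subproducts (h ::ₘ M)).image (QuotientGroup.mk : G → G ⧸ H) with hZ
    have hYZ : Y ⊆ Z := image_subset_image (subproducts_mono (Multiset.le_cons_self M h))
    have hhYZ : ∀ y ∈ Y, h • y ∈ Z := by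
      intro y hy
      obtain ⟨g, hg, rfl⟩ := mem_image.1 hy
      refine mem_image.2 ⟨h * g, ?_, rfl⟩
      rw [← Multiset.singleton_add]
      exact mul_mem_subproducts (mem_subproducts_singleton h) hg
    by_cases hst : ∀ y ∈ Y, h • y ∈ Y
    · -- `Y` contains the orbit of the trivial coset under the powers of `h`
      refine (min_le_left _ _).trans (le_trans ?_ (card_le_card hYZ))
      have h1Y : ((1 : G) : G ⧸ H) ∈ Y := mem_image_of_mem _ (one_mem_subproducts M)
      have hpow : ∀ n : ℕ, (h ^ n) • ((1 : G) : G ⧸ H) ∈ Y := by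
        intro n
        induction n with
        | zero => simpa using h1Y
        | succ n ihn => rw [pow_succ', mul_smul]; exact hst _ ihn
      have horb : MulAction.orbit (Subgroup.zpowers h) ((1 : G) : G ⧸ H) ⊆ Y := by
        rintro _ ⟨⟨g, hg⟩, rfl⟩
        obtain ⟨n, rfl⟩ := (mem_powers_iff_mem_zpowers.2 hg)
        exact hpow n
      have hle : (MulAction.orbit (Subgroup.zpowers h) ((1 : G) : G ⧸ H)).ncard ≤ #Y := by
        rw [← Set.ncard_coe_finset]
        exact Set.ncard_le_ncard horb (Set.toFinite _)
      refine le_trans (hp _ ?_ ?_) hle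
      · rw [← MulAction.index_stabilizer]
        exact (Subgroup.index_dvd_card _).trans (Subgroup.card_subgroup_dvd_card _)
      · intro hone
        obtain ⟨w, hw⟩ := Set.ncard_eq_one.1 hone
        have e1 : ((1 : G) : G ⧸ H) ∈ MulAction.orbit (Subgroup.zpowers h) ((1 : G) : G ⧸ H) :=
          MulAction.mem_orbit_self _
        have e2 : ((h : G) : G ⧸ H) ∈ MulAction.orbit (Subgroup.zpowers h) ((1 : G) : G ⧸ H) :=
          ⟨⟨h, Subgroup.mem_zpowers h⟩, by
            change ((h * 1 : G) : G ⧸ H) = _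
            rw [mul_one]⟩
        rw [hw, Set.mem_singleton_iff] at e1 e2
        have e3 := e1.trans e2.symm
        rw [QuotientGroup.eq] at e3
        exact hM h (Multiset.mem_cons_self h M) (by simpa using e3)
    · push Not at hst
      obtain ⟨y, hy, hhy⟩ := hst
      have : #Y < #Z := card_lt_card ⟨hYZ, fun hcon => hhy (hcon (hhYZ y hy))⟩
      rw [Multiset.card_cons]
      omega

theorem min_mul_card_subproducts_le (H : Subgroup G) (p : ℕ)
    (hp : ∀ d, d ∣ Nat.card G → d ≠ 1 → p ≤ d) (M T : Multiset G) (hM : ∀ x ∈ M, x ∉ H)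
    (hT : ∀ x ∈ T, x ∈ H) :
    min p (M.card + 1) * #(subproducts T) ≤ #(subproducts (M + T)) := by
  classical
  obtain ⟨R, hR, hRc, hRi⟩ : ∃ R ⊆ subproducts M, min p (M.card + 1) ≤ #R ∧
      Set.InjOn (QuotientGroup.mk : G → G ⧸ H) (R : Set G) := by
    obtain ⟨R, hR, hRi, hRe⟩ := exists_subset_injOn_image_eq_of_surjOn
      (f := (QuotientGroup.mk : G → G ⧸ H)) (subproducts M : Set G)
      ((subproducts M).image QuotientGroup.mk) (by rw [coe_image]; exact Set.surjOn_image _ _)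
    refine ⟨R, by exact_mod_cast hR, ?_, hRi⟩
    rw [← card_image_of_injOn hRi, hRe]
    exact min_le_card_image_subproducts H p hp M hM
  calc _ ≤ #R * #(subproducts T) := Nat.mul_le_mul_right _ hRc
    _ = #(R ×ˢ subproducts T) := (card_product _ _).symm
    _ ≤ _ := by
      refine card_le_card_of_injOn (fun q => q.1 * q.2) ?_ ?_
      · rintro ⟨r, t⟩ hq
        simp only [coe_product, Set.mem_prod, mem_coe] at hq
        exact mul_mem_subproducts (hR hq.1) hq.2
      · rintro ⟨r, t⟩ hq ⟨r', t'⟩ hq' heq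
        simp only [coe_product, Set.mem_prod, mem_coe] at hq hq' heq
        have hr : r = r' := hRi hq.1 hq'.1 (by
          rw [QuotientGroup.eq]
          have : r⁻¹ * r' = t * t'⁻¹ := by
            rw [eq_mul_inv_iff_mul_eq, mul_assoc, ← heq, inv_mul_cancel_left]
          rw [this]
          exact mul_mem (mem_of_mem_subproducts hT hq.2) (inv_mem (mem_of_mem_subproducts hT hq'.2)))
        subst hr
        simpa using heq

end Subproducts

/-! ### Sets of distinct terms -/

section Growth

open scoped Pointwise
open Finset

variable {G : Type*} [Group G] [Finite G] [DecidableEq G]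

omit [Finite G] in
/-- Translation by `a⁻¹` moves as many elements out of `B` as translation by `a`. -/
theorem card_mul_singleton_inv_sdiff (B : Finset G) (a : G) :
    #((B * {a⁻¹}) \ B) = #((B * {a}) \ B) := by
  have h1 : ((B * {a⁻¹}) \ B) * {a} = B \ (B * {a}) := by
    ext y
    simp only [mem_mul, mem_sdiff, mem_singleton, exists_eq_left]
    constructor
    · rintro ⟨_, ⟨⟨b, hb, rfl⟩, hB⟩, rfl⟩
      refine ⟨by simpa using hb, ?_⟩
      rintro ⟨c, hc, hca⟩
      rw [mul_left_inj] at hca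
      exact hB (hca ▸ hc)
    · rintro ⟨hy, hya⟩
      exact ⟨y * a⁻¹, ⟨⟨y, hy, rfl⟩, fun h => hya ⟨_, h, by simp⟩⟩, by simp⟩
  rw [← card_mul_singleton _ a, h1]
  have h2 := card_sdiff_add_card_inter B (B * {a})
  have h3 := card_sdiff_add_card_inter (B * {a}) B
  rw [card_mul_singleton, inter_comm] at h3
  omega

omit [Finite G] in
/-- Translation moves no more elements out of the complement of `B` than out of `B`. -/
theorem card_sdiff_mul_singleton_sdiff_le (H B : Finset G) (x : G)
    (hx : H * {x} = H) : #(((H \ B) * {x}) \ (H \ B)) ≤ #((B * {x}) \ B) := by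
  have hsub : ((H \ B) * {x}) \ (H \ B) ⊆ B \ (B * {x}) := by
    intro y hy
    obtain ⟨hy1, hy2⟩ := mem_sdiff.1 hy
    obtain ⟨z, hz, _, hx', rfl⟩ := mem_mul.1 hy1
    rw [mem_singleton.1 hx'] at hy2 ⊢
    have hzH : z * x ∈ H := by
      rw [← hx]; exact mul_mem_mul (mem_sdiff.1 hz).1 (mem_singleton_self x)
    refine mem_sdiff.2 ⟨by by_contra hc; exact hy2 (mem_sdiff.2 ⟨hzH, hc⟩), fun hc => ?_⟩
    obtain ⟨b, hb, _, hx'', hbx⟩ := mem_mul.1 hc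
    rw [mem_singleton.1 hx'', mul_left_inj] at hbx
    exact (mem_sdiff.1 hz).2 (hbx ▸ hb)
  have h2 := card_sdiff_add_card_inter B (B * {x})
  have h3 := card_sdiff_add_card_inter (B * {x}) B
  rw [card_mul_singleton, inter_comm] at h3
  have := card_le_card hsub
  omega

/-- A suitable term of `A` can be appended to `S` with a gain in subproducts controlled by the growth
lemma. If the set of subproducts of `S` fills more than half of the group generated by `A`, the
lemma is applied to its complement, which contains the inverses of the elements of `A`. -/
theorem exists_card_subproducts_cons_ge (S : Multiset G) (A : Finset G)
    (hfree : IsOneProductFree (S + A.val)) (hA : A.Nonempty)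
    (hgen : ∀ x ∈ S, x ∈ Subgroup.closure (A : Set G)) :
    ∃ a ∈ A, ∃ L, #(subproducts S) + L ≤ #(subproducts (a ::ₘ S)) ∧
      (#(subproducts S) ≤ 2 * L ∨ #A ≤ 2 * L ∨ #(insert 1 (A ∪ A⁻¹)) ≤ 4 * L) := by
  set B := subproducts S with hB
  obtain ⟨a, ha, hmax⟩ := exists_max_image A (fun x => #((B * {x}) \ B)) hA
  refine ⟨a, ha, #((B * {a}) \ B), ?_, ?_⟩
  · have hsub : B ∪ (B * {a}) \ B ⊆ subproducts (a ::ₘ S) := by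
      refine union_subset (subproducts_mono (Multiset.le_cons_self S a)) ?_
      refine sdiff_subset.trans fun y hy => ?_
      obtain ⟨b, hb, _, hx, rfl⟩ := mem_mul.1 hy
      rw [mem_singleton.1 hx, ← Multiset.singleton_add, add_comm]
      exact mul_mem_subproducts hb (mem_subproducts_singleton a)
    rw [← card_union_of_disjoint disjoint_sdiff]
    exact card_le_card hsub
  · set L := #((B * {a}) \ B) with hL
    set E := insert 1 (A ∪ A⁻¹) with hE
    let H : Finset G := (Set.toFinite (Subgroup.closure (A : Set G) : Set G)).toFinset
    have hHmem : ∀ x, x ∈ H ↔ x ∈ Subgroup.closure (A : Set G) := by simp [H]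
    have hAE : (A : Set G) ⊆ E := by
      intro x hx
      simp only [hE, coe_insert, coe_union]
      exact Or.inr (Or.inl hx)
    have hEcl : ∀ x ∈ E, x ∈ Subgroup.closure (A : Set G) := by
      intro x hx
      simp only [hE, mem_insert, mem_union, mem_inv'] at hx
      rcases hx with rfl | hx | hx
      · exact one_mem _
      · exact Subgroup.subset_closure hx
      · exact inv_mem_iff.1 (Subgroup.subset_closure hx)
    have hHE : ∀ x, x ∈ H ↔ x ∈ Subgroup.closure (E : Set G) := by
      intro x
      rw [hHmem]
      exact ⟨fun h => Subgroup.closure_mono hAE h, fun h => (Subgroup.closure_le _).2 hEcl h⟩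
    have hEinv : ∀ x ∈ E, x⁻¹ ∈ E := by
      intro x hx
      simp only [hE, mem_insert, mem_union, mem_inv', inv_inv, inv_eq_one] at hx ⊢
      tauto
    have hEL : ∀ x ∈ E, #((B * {x}) \ B) ≤ L := by
      intro x hx
      simp only [hE, mem_insert, mem_union, mem_inv'] at hx
      rcases hx with rfl | hx | hx
      · rw [singleton_one, mul_one]; simp
      · exact hmax x hx
      · rw [← card_mul_singleton_inv_sdiff]; exact hmax _ hx
    have hBH : B ⊆ H := fun g hg => (hHmem g).2 (mem_of_mem_subproducts hgen hg)
    by_cases hhalf : 2 * #B ≤ #H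
    · rcases card_le_or_card_le_of_forall_card_mul_singleton_sdiff_le E H (mem_insert_self _ _)
        hEinv hHE B ⟨1, one_mem_subproducts S⟩ hhalf L hEL with h | h
      · exact Or.inl h
      · exact Or.inr (Or.inr h)
    · -- the inverses of the elements of `A` lie in the complement of `B`
      have hAD : #A ≤ #(H \ B) := by
        refine card_le_card_of_injOn (fun x => x⁻¹) (fun x hx => ?_) (fun x _ y _ h => by simpa using h)
        refine mem_sdiff.2 ⟨(hHmem _).2 (inv_mem (Subgroup.subset_closure hx)), fun hxB => ?_⟩
        have hxs : x ∈ subproducts A.val := subproducts_mono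
          (Multiset.singleton_le.2 hx) (mem_subproducts_singleton x)
        have := hfree.eq_one_of_mul_eq_one hxB hxs (by simp)
        exact hfree.ne_one (a := x) (Multiset.mem_add.2 (Or.inr hx)) (by simpa using this)
      have hc := card_sdiff_add_card_eq_card hBH
      have hDpos : 0 < #(H \ B) := hA.card_pos.trans_le hAD
      have hDL : ∀ x ∈ E, #(((H \ B) * {x}) \ (H \ B)) ≤ L := by
        intro x hx
        refine (card_sdiff_mul_singleton_sdiff_le H B x ?_).trans (hEL x hx)
        refine eq_of_subset_of_card_le (fun y hy => ?_) (by rw [card_mul_singleton])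
        obtain ⟨z, hz, _, hx', rfl⟩ := mem_mul.1 hy
        rw [mem_singleton.1 hx']
        exact (hHmem _).2 (mul_mem ((hHmem _).1 hz) (hEcl x hx))
      rcases card_le_or_card_le_of_forall_card_mul_singleton_sdiff_le E H (mem_insert_self _ _)
        hEinv hHE (H \ B) (card_pos.1 hDpos) (by omega) L hDL with h | h
      · exact Or.inr (Or.inl (hAD.trans h))
      · exact Or.inr (Or.inr h)

/-- The number of subproducts guaranteed after `i` greedy steps, each multiplying it by `3 / 2` or
adding `m`, whichever is less. -/
def growthBound (m : ℕ) : ℕ → ℕ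
  | 0 => 1
  | i + 1 => growthBound m i + min ((growthBound m i + 1) / 2) m

omit [Group G] [Finite G] in
theorem val_add_sdiff_val {A B : Finset G} (h : A ⊆ B) : A.val + (B \ A).val = B.val := by
  rw [sdiff_val, add_tsub_cancel_of_le (val_le_iff.2 h)]

/-- Greedy selection from a one-product free set `A` in which any `q` elements generate a subgroup
containing all of `A`. As long as at least `q` elements remain, the growth lemma applies to them. -/
theorem exists_subset_growthBound_le (A : Finset G) (hfree : IsOneProductFree A.val) (q m : ℕ)
    (hq0 : 0 < q) (hq : ∀ K : Subgroup G, (∃ B ⊆ A, q ≤ #B ∧ ∀ b ∈ B, b ∈ K) → ∀ a ∈ A, a ∈ K)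
    (hm : 2 * m ≤ q + 1) (hE : ∀ B ⊆ A, q ≤ #B → 4 * m ≤ #(insert 1 (B ∪ B⁻¹)) + 3)
    (i : ℕ) (hi : i + q ≤ #A + 1) :
    ∃ A₁ ⊆ A, #A₁ = i ∧ growthBound m i ≤ #(subproducts A₁.val) := by
  induction i with
  | zero => exact ⟨∅, empty_subset _, rfl, card_pos.2 ⟨1, one_mem_subproducts _⟩⟩
  | succ i ih =>
    obtain ⟨A₁, hA₁, hc, hg⟩ := ih (by omega)
    have hc2 : q ≤ #(A \ A₁) := by rw [card_sdiff_of_subset hA₁]; omega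
    obtain ⟨a, ha, L, h1, h2⟩ := exists_card_subproducts_cons_ge A₁.val (A \ A₁)
      (by rw [val_add_sdiff_val hA₁]; exact hfree) (card_pos.1 (by omega))
      (fun x hx => hq _ ⟨_, sdiff_subset, hc2, fun b hb => Subgroup.subset_closure hb⟩ x (hA₁ hx))
    obtain ⟨haA, haA₁⟩ := mem_sdiff.1 ha
    refine ⟨insert a A₁, insert_subset haA hA₁, by rw [card_insert_of_notMem haA₁, hc], ?_⟩
    rw [insert_val_of_notMem haA₁]
    refine le_trans ?_ h1
    have h3 := hE _ sdiff_subset hc2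
    have h4 : min ((#(subproducts A₁.val) + 1) / 2) m ≤ L := by omega
    rw [growthBound]
    omega

theorem subproductCount_add_sdiff_le {A B : Finset G} (hB : IsOneProductFree B.val) (h : A ⊆ B) :
    subproductCount A.val + subproductCount (B \ A).val ≤ subproductCount B.val := by
  rw [← val_add_sdiff_val h] at hB ⊢
  exact subproductCount_add_le hB

/-- Two distinct terms `a`, `b` contribute the three subproducts `a`, `b`, `ab`. -/
theorem three_mul_card_div_two_le (A : Finset G) (hfree : IsOneProductFree A.val) :
    3 * (#A / 2) ≤ subproductCount A.val := by
  induction hk : #A using Nat.strong_induction_on generalizing A with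
  | _ k ih =>
    by_cases h2 : k < 2
    · rw [Nat.div_eq_of_lt h2]; simp
    · obtain ⟨a, ha, b, hb, hab⟩ := one_lt_card.1 (show 1 < #A by omega)
      have hsub : {a, b} ⊆ A := by simp [insert_subset_iff, ha, hb]
      have hfree' : IsOneProductFree (A \ {a, b}).val :=
        hfree.mono (val_le_iff.2 sdiff_subset)
      have hc : #(A \ {a, b}) = k - 2 := by
        rw [card_sdiff_of_subset hsub, hk, card_pair hab]
      have h3 := ih (k - 2) (by omega) _ hfree' hc
      have h4 := subproductCount_add_sdiff_le hfree hsub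
      have ha1 := hfree.ne_one (a := a) ha
      have hb1 := hfree.ne_one (a := b) hb
      have hval : ({a, b} : Finset G).val = {a} + {b} := by
        rw [insert_val_of_notMem (by simpa using hab)]; rfl
      have hab1 : a * b ≠ 1 := fun h => by
        have := hfree.eq_nil (l := [a, b]) (hval.symm.le.trans (val_le_iff.2 hsub))
          (by simpa using h)
        simp at this
      have h5 : ({1, a, b, a * b} : Finset G) ⊆ subproducts ({a, b} : Finset G).val := by
        rw [hval]
        simp only [insert_subset_iff, singleton_subset_iff]
        refine ⟨one_mem_subproducts _, ?_, ?_, ?_⟩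
        · simpa using mul_mem_subproducts (mem_subproducts_singleton a) (one_mem_subproducts {b})
        · simpa using mul_mem_subproducts (one_mem_subproducts {a}) (mem_subproducts_singleton b)
        · exact mul_mem_subproducts (mem_subproducts_singleton a) (mem_subproducts_singleton b)
      have h6 := card_le_card h5
      rw [card_insert_of_notMem (by simp [ha1.symm, hb1.symm, hab1.symm]),
        card_insert_of_notMem (by simp [hab, hb1]), card_insert_of_notMem (by simp [ha1]),
        card_singleton, card_subproducts] at h6
      omega

/-- The set bound needed for `p = 2`. Either some proper subgroup contains at least `22` but not all of
the elements, and an element outside doubles the number of subproducts, or greedy growth applies. -/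
theorem le_subproductCount_of_card_eq_thirty_three (A : Finset G)
    (hp : ∀ d, d ∣ Nat.card G → d ≠ 1 → 2 ≤ d)
    (hfree : IsOneProductFree A.val) (hA : #A = 33) : 66 ≤ subproductCount A.val := by
  classical
  by_cases hK : ∃ K : Subgroup G, (∃ B ⊆ A, 22 ≤ #B ∧ ∀ b ∈ B, b ∈ K) ∧ ∃ a ∈ A, a ∉ K
  · obtain ⟨K, ⟨B, hB, hBc, hBK⟩, a, ha, haK⟩ := hK
    have haB : a ∉ B := fun h => haK (hBK a h)
    have h1 := three_mul_card_div_two_le B (hfree.mono (val_le_iff.2 hB))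
    have h2 := min_mul_card_subproducts_le K 2 hp {a} B.val (by simpa using haK) hBK
    have h3 := subproductCount_mono (val_le_iff.2 (insert_subset ha hB))
    rw [insert_val_of_notMem haB, ← Multiset.singleton_add] at h3
    rw [card_subproducts, card_subproducts, Multiset.card_singleton, min_self] at h2
    omega
  · push Not at hK
    obtain ⟨A₁, hA₁, hc, hg⟩ := exists_subset_growthBound_le A hfree 22 6 (by norm_num) hK
      (by norm_num) (fun B hB hBc => by
        have : #(insert 1 B) ≤ #(insert 1 (B ∪ B⁻¹)) :=
          card_le_card (insert_subset_insert _ subset_union_left)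
        rw [card_insert_of_notMem (fun h => hfree.ne_one (hB h) rfl)] at this
        omega) 12 (by omega)
    have h54 : growthBound 6 12 = 54 := by decide
    rw [h54, card_subproducts] at hg
    have h1 := subproductCount_add_sdiff_le hfree hA₁
    have h2 := card_le_subproductCount (hfree.mono (val_le_iff.2 (sdiff_subset (s := A) (t := A₁))))
    have h3 : #(A \ A₁) = 21 := by rw [card_sdiff_of_subset hA₁]; omega
    rw [card_val, h3] at h2
    omega

/-- Integer growth by the factor `3 / 2`, rounded up at each step. -/
def threeHalvesGrowth : ℕ → ℕ
  | 0 => 1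
  | i + 1 => threeHalvesGrowth i + (threeHalvesGrowth i + 1) / 2

theorem le_threeHalvesGrowth (i : ℕ) : 12 * i ^ 2 ≤ 25 * threeHalvesGrowth i := by
  have key : ∀ i, 5 ≤ i → 12 * i ^ 2 ≤ 25 * threeHalvesGrowth i := by
    intro i hi
    induction i, hi using Nat.le_induction with
    | base => decide
    | succ i hi ih =>
      rw [threeHalvesGrowth]
      have : threeHalvesGrowth i ≤ 2 * ((threeHalvesGrowth i + 1) / 2) := by omega
      nlinarith
  rcases lt_or_ge i 5 with h | h
  · interval_cases i <;> decide
  · exact key i h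

/-- Quadratic-type lower bound for `growthBound`. While its value is below `q` it grows at least like
`12 / 25 * i ^ 2`, which dominates the line `q / 2 * i - 25 / 192 * q ^ 2` by the inequality of
arithmetic and geometric means; afterwards each step adds at least `q / 2`. -/
theorem le_growthBound (q m : ℕ) (hm : q ≤ 2 * m) (i : ℕ) :
    (q / 2 : ℝ) * i - 25 / 192 * q ^ 2 ≤ growthBound m i := by
  have key : (threeHalvesGrowth i ≤ growthBound m i) ∨
      (q ≤ growthBound m i ∧ (q / 2 : ℝ) * i - 25 / 192 * q ^ 2 ≤ growthBound m i) := by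
    induction i with
    | zero => left; simp [threeHalvesGrowth, growthBound]
    | succ i ih =>
      have hamgm : threeHalvesGrowth i ≤ growthBound m i →
          (q / 2 : ℝ) * i - 25 / 192 * q ^ 2 ≤ growthBound m i := by
        intro h
        have h1 : (12 * i ^ 2 : ℝ) ≤ 25 * threeHalvesGrowth i := by exact_mod_cast le_threeHalvesGrowth i
        have h2 : (threeHalvesGrowth i : ℝ) ≤ growthBound m i := by exact_mod_cast h
        nlinarith [sq_nonneg ((24 : ℝ) * i - 25 / 2 * q)]
      by_cases hq : q ≤ growthBound m i
      · right
        have h1 : (q / 2 : ℝ) * i - 25 / 192 * q ^ 2 ≤ growthBound m i := by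
          rcases ih with ih | ih
          · exact hamgm ih
          · exact ih.2
        have h2 : 2 * growthBound m i + q ≤ 2 * growthBound m (i + 1) := by
          rw [growthBound]; omega
        refine ⟨by omega, ?_⟩
        have h3 : (2 * growthBound m i + q : ℝ) ≤ 2 * growthBound m (i + 1) := by exact_mod_cast h2
        push_cast
        linarith
      · left
        have h1 : threeHalvesGrowth i ≤ growthBound m i := ih.resolve_right fun h => hq h.1
        rw [threeHalvesGrowth, growthBound]
        omega
  rcases key with h | h
  · have h1 : (12 * i ^ 2 : ℝ) ≤ 25 * threeHalvesGrowth i := by exact_mod_cast le_threeHalvesGrowth i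
    have h2 : (threeHalvesGrowth i : ℝ) ≤ growthBound m i := by exact_mod_cast h
    nlinarith [sq_nonneg ((24 : ℝ) * i - 25 / 2 * q)]
  · exact h.2

/-- Here `q` is the least number for which `q` elements of a `k`-element set in a proper subgroup make
the subgroup case of the induction work; the conclusion says that otherwise the growth case works.
For fixed `q` the difference of the two sides is concave in `k`, so it is enough to look at the
ends of an interval containing `k`. -/
theorem growth_threshold_inequality (k q : ℕ) (hk : 19 ≤ k) (hq : 10 ≤ q) (hqk : q ≤ k)
    (h1 : (k * (k - 9) : ℝ) ≤ 3 * q * (q - 9) + 18)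
    (h2 : (3 * (q - 1) * (q - 10) + 19 : ℝ) ≤ k * (k - 9)) :
    (k * (k - 9) : ℝ) ≤
      9 * (q / 2 * (k - q + 1) - 25 / 192 * q ^ 2 - 1) + (q - 1) * (q - 10) := by
  by_cases hk26 : k < 26
  · revert h1 h2
    interval_cases k <;> interval_cases q <;> norm_num
  · have hk' : (26 : ℝ) ≤ k := by exact_mod_cast not_lt.1 hk26
    have hq' : (10 : ℝ) ≤ q := by exact_mod_cast hq
    have hq18 : (18 : ℝ) ≤ q := by
      have : 17 < q := by
        by_contra! hcon
        have : (q : ℝ) ≤ 17 := by exact_mod_cast hcon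
        nlinarith
      exact_mod_cast this
    have hhi : (k : ℝ) ≤ 1.7321 * q - 3.29 := by
      by_contra! hlt
      nlinarith
    have hlo : 1.73 * q - 5.6 ≤ (k : ℝ) := by
      by_contra! hlt
      nlinarith
    nlinarith [mul_nonneg (sub_nonneg.2 hlo) (sub_nonneg.2 hhi)]

omit [DecidableEq G] in
/-- The quadratic bound `φ(A) ≥ |A| (|A| - 9) / 9` on the number of nonidentity subproducts of a
one-product free set in a group of odd order. Either a proper subgroup contains many but not all of
the elements, and those outside triple the number of subproducts (double it, if there is only one),
or greedy growth applies until the remaining elements cease to generate. -/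
theorem card_mul_sub_nine_le (A : Finset G) (hp : ∀ d, d ∣ Nat.card G → d ≠ 1 → 3 ≤ d)
    (hfree : IsOneProductFree A.val) :
    (#A * (#A - 9) : ℝ) ≤ 9 * subproductCount A.val := by
  classical
  induction hk : #A using Nat.strong_induction_on generalizing A with
  | _ k ih =>
  have hlin : (k : ℝ) ≤ subproductCount A.val := by
    have := card_le_subproductCount hfree
    rw [card_val, hk] at this
    exact_mod_cast this
  by_cases hk19 : k < 19
  · have : (k : ℝ) ≤ 18 := by exact_mod_cast Nat.lt_succ_iff.1 hk19
    nlinarith [(Nat.cast_nonneg k : (0 : ℝ) ≤ k)]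
  push Not at hk19
  have hk19' : (19 : ℝ) ≤ k := by exact_mod_cast hk19
  have hex : ∃ q : ℕ, 10 ≤ q ∧ (k * (k - 9) : ℝ) ≤ 3 * q * (q - 9) + 18 :=
    ⟨k, by omega, by nlinarith⟩
  obtain ⟨q, ⟨hq10, hq1⟩, hqmin⟩ : ∃ q : ℕ, (10 ≤ q ∧ (k * (k - 9) : ℝ) ≤ 3 * q * (q - 9) + 18) ∧
      ∀ r < q, ¬ (10 ≤ r ∧ (k * (k - 9) : ℝ) ≤ 3 * r * (r - 9) + 18) :=
    ⟨Nat.find hex, Nat.find_spec hex, fun r hr => Nat.find_min hex hr⟩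
  have hqk : q ≤ k := by
    by_contra! hlt
    exact hqmin k hlt ⟨by omega, by nlinarith⟩
  have hq10' : (10 : ℝ) ≤ q := by exact_mod_cast hq10
  have hq2 : (3 * (q - 1) * (q - 10) + 19 : ℝ) ≤ k * (k - 9) := by
    have hq11 : 11 ≤ q := by
      by_contra! hlt
      have : (q : ℝ) ≤ 10 := by exact_mod_cast Nat.lt_succ_iff.1 hlt
      nlinarith
    have := hqmin (q - 1) (by omega)
    push Not at this
    have h := this (by omega)
    obtain ⟨r, rfl⟩ := Nat.exists_eq_add_of_le hq11
    obtain ⟨j, rfl⟩ := Nat.exists_eq_add_of_le hk19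
    rw [show 11 + r - 1 = 10 + r by omega] at h
    push_cast at h ⊢
    have h' : 3 * (10 + r) * (1 + r) + 18 < (19 + j) * (10 + j) := by
      have : (3 * (10 + r) * (1 + r) + 18 : ℝ) < (19 + j) * (10 + j) := by linarith
      exact_mod_cast this
    have h'' : (3 * (10 + r) * (1 + r) + 18 + 1 : ℝ) ≤ (19 + j) * (10 + j) := by exact_mod_cast h'
    linarith
  by_cases hK : ∃ K : Subgroup G, (∃ B ⊆ A, q ≤ #B ∧ ∀ b ∈ B, b ∈ K) ∧ ∃ a ∈ A, a ∉ K
  · obtain ⟨K, ⟨B₀, hB₀, hB₀c, hB₀K⟩, a, ha, haK⟩ := hK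
    set B := A.filter (· ∈ K) with hB
    have hBA : B ⊆ A := filter_subset _ _
    have hqB : q ≤ #B := hB₀c.trans
      (card_le_card fun b hb => mem_filter.2 ⟨hB₀ hb, hB₀K b hb⟩)
    have hBlt : #B < k := by
      rw [← hk]
      exact card_lt_card ⟨hBA, fun hcon => haK (mem_filter.1 (hcon ha)).2⟩
    have h1 := ih #B hBlt B (hfree.mono (val_le_iff.2 hBA)) rfl
    have h2 := min_mul_card_subproducts_le K 3 hp (A \ B).val B.val
      (fun x hx hxK => by
        obtain ⟨hxA, hxB⟩ := mem_sdiff.1 hx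
        exact hxB (mem_filter.2 ⟨hxA, hxK⟩))
      (fun x hx => (mem_filter.1 hx).2)
    rw [add_comm (A \ B).val, val_add_sdiff_val hBA, card_val, card_sdiff_of_subset hBA, hk,
      card_subproducts, card_subproducts] at h2
    have hqB' : (q : ℝ) ≤ #B := by exact_mod_cast hqB
    by_cases hB1 : #B + 1 = k
    · rw [show min 3 (k - #B + 1) = 2 by omega] at h2
      have h3 : (2 * (subproductCount B.val + 1) : ℝ) ≤ subproductCount A.val + 1 := by
        exact_mod_cast h2
      have h4 : (k : ℝ) = #B + 1 := by exact_mod_cast hB1.symm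
      rw [h4] at hk19' ⊢
      nlinarith
    · rw [show min 3 (k - #B + 1) = 3 by omega] at h2
      have h3 : (3 * (subproductCount B.val + 1) : ℝ) ≤ subproductCount A.val + 1 := by
        exact_mod_cast h2
      nlinarith
  · push Not at hK
    -- there are no involutions, so `A` and `A⁻¹` are disjoint
    have hinv : ∀ x : G, x * x = 1 → x = 1 := by
      intro x hx
      by_contra hx1
      have h3 := hp (orderOf x) (orderOf_dvd_natCard x) (by rwa [Ne, orderOf_eq_one_iff])
      have h2 := Nat.le_of_dvd (by norm_num) (orderOf_dvd_of_pow_eq_one (x := x) (n := 2) (by rw [sq, hx]))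
      omega
    have hE : ∀ B ⊆ A, q ≤ #B → 4 * ((q + 1) / 2) ≤ #(insert 1 (B ∪ B⁻¹)) + 3 := by
      intro B hB hBc
      have hd : Disjoint B B⁻¹ := by
        rw [disjoint_left]
        intro x hx hx'
        rw [mem_inv'] at hx'
        have hx1 := hfree.ne_one (hB hx)
        have hne : x ≠ x⁻¹ := fun h => hx1 (hinv x (mul_eq_one_iff_eq_inv.2 h))
        have hle : (([x, x⁻¹] : List G) : Multiset G) ≤ A.val := by
          refine (Multiset.le_iff_subset (by simpa using hne)).2 ?_
          intro y hy
          simp only [Multiset.mem_coe, List.mem_cons, List.not_mem_nil, or_false] at hy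
          rcases hy with rfl | rfl
          · exact hB hx
          · exact hB hx'
        have := hfree.eq_nil (l := [x, x⁻¹]) hle (by simp)
        simp at this
      have h1 : (1 : G) ∉ B ∪ B⁻¹ := by
        simp only [mem_union, mem_inv', inv_one, or_self]
        exact fun h => hfree.ne_one (hB h) rfl
      rw [card_insert_of_notMem h1, card_union_of_disjoint hd, card_inv]
      omega
    obtain ⟨A₁, hA₁, hc, hg⟩ := exists_subset_growthBound_le A hfree q ((q + 1) / 2) (by omega) hK
      (by omega) hE (k - q + 1) (by omega)
    have h1 := le_growthBound q ((q + 1) / 2) (by omega) (k - q + 1)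
    have h2 := subproductCount_add_sdiff_le hfree hA₁
    have hcA : #(A \ A₁) = q - 1 := by rw [card_sdiff_of_subset hA₁]; omega
    have h3 := ih (q - 1) (by omega) (A \ A₁) (hfree.mono (val_le_iff.2 sdiff_subset)) hcA
    have h4 := growth_threshold_inequality k q hk19 hq10 hqk hq1 hq2
    rw [card_subproducts] at hg
    have hg' : (growthBound ((q + 1) / 2) (k - q + 1) : ℝ) ≤ subproductCount A₁.val + 1 := by
      exact_mod_cast hg
    have h2' : (subproductCount A₁.val + subproductCount (A \ A₁).val : ℝ) ≤
        subproductCount A.val := by exact_mod_cast h2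
    push_cast [Nat.cast_sub hqk, Nat.cast_sub (show 1 ≤ q by omega)] at h1 h3
    linarith

end Growth

/-! ### Sequences with repeated terms -/

section Main

open scoped Pointwise
open Finset

variable {G : Type*} [Group G] [Finite G]

/-- A size `k`, linear in `p`, such that every one-product free set of size `k` has at least `p`
subproducts for each of its elements, and small enough for the two error terms of the final
estimate. -/
theorem exists_set_size (p : ℕ) (hp2 : 2 ≤ p) (hp : ∀ d, d ∣ Nat.card G → d ≠ 1 → p ≤ d) :
    ∃ k, 0 < k ∧ (p - 1) ^ 2 * (k - 1) + 10 * p ^ 2 ≤ 9 * p ^ 3 ∧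
      (p - 1) * (k + p - 2) + 10 * p ^ 2 ≤ 9 * p ^ 3 + 1 ∧
      ∀ A : Finset G, IsOneProductFree A.val → #A = k → p * k ≤ subproductCount A.val := by
  classical
  rcases hp2.eq_or_lt with rfl | hp3
  · exact ⟨33, by norm_num, by norm_num, by norm_num, fun A hA hk =>
      le_subproductCount_of_card_eq_thirty_three A hp hA hk⟩
  · refine ⟨9 * p + 9, by omega, ?_, ?_, fun A hA hk => ?_⟩
    · obtain ⟨r, rfl⟩ := Nat.exists_eq_add_of_le (show 3 ≤ p by omega)
      rw [show 3 + r - 1 = r + 2 by omega, show 9 * (3 + r) + 9 - 1 = 9 * r + 35 by omega]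
      nlinarith
    · obtain ⟨r, rfl⟩ := Nat.exists_eq_add_of_le (show 3 ≤ p by omega)
      rw [show 3 + r - 1 = r + 2 by omega,
        show 9 * (3 + r) + 9 + (3 + r) - 2 = 10 * r + 37 by omega]
      nlinarith [Nat.zero_le (r ^ 3), Nat.zero_le (r ^ 2)]
    · have h := card_mul_sub_nine_le A (fun d hd hd1 => hp3.trans_le (hp d hd hd1)) hA
      rw [hk] at h
      push_cast at h
      have h' : (p * (9 * p + 9) : ℝ) ≤ subproductCount A.val := by linarith
      exact_mod_cast h'

omit [Group G] [Finite G] in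
/-- Splitting off sets of size `k` until fewer than `k` distinct terms are left. -/
theorem exists_finsets_add_eq [DecidableEq G] (k : ℕ) (hk : 0 < k) (S : Multiset G) :
    ∃ (L : Multiset (Finset G)) (T : Multiset G), (L.map val).sum + T = S ∧
      (∀ A ∈ L, #A = k) ∧ #T.toFinset < k := by
  induction hc : S.card using Nat.strong_induction_on generalizing S with
  | _ c ih =>
    by_cases hS : #S.toFinset < k
    · exact ⟨0, S, by simp, by simp, hS⟩
    · obtain ⟨A, hA, hAk⟩ := exists_subset_card_eq (not_lt.1 hS)
      have hle : A.val ≤ S := (val_le_iff.2 hA).trans (Multiset.dedup_le S)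
      obtain ⟨L, T, hsum, hL, hT⟩ := ih (S - A.val).card (by
        rw [Multiset.card_sub hle, card_val]
        have := Multiset.card_le_card hle
        rw [card_val] at this
        omega) (S - A.val) rfl
      refine ⟨A ::ₘ L, T, ?_, ?_, hT⟩
      · rw [Multiset.map_cons, Multiset.sum_cons, add_assoc, hsum, add_tsub_cancel_of_le hle]
      · intro B hB
        rcases Multiset.mem_cons.1 hB with rfl | hB
        · exact hAk
        · exact hL B hB

theorem mul_card_sum_le (p k : ℕ) (L : Multiset (Finset G)) (hL : ∀ A ∈ L, #A = k)
    (hk : ∀ A : Finset G, IsOneProductFree A.val → #A = k → p * k ≤ subproductCount A.val)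
    (hfree : IsOneProductFree (L.map val).sum) :
    p * (L.map val).sum.card ≤ subproductCount (L.map val).sum := by
  induction L using Multiset.induction_on with
  | empty => simp
  | cons A L ih =>
    rw [Multiset.map_cons, Multiset.sum_cons] at hfree ⊢
    have h1 := ih (fun B hB => hL B (Multiset.mem_cons_of_mem hB))
      (hfree.mono (Multiset.le_add_left _ _))
    have hA := hL A (Multiset.mem_cons_self _ _)
    have h2 := hk A (hfree.mono (Multiset.le_add_right _ _)) hA
    have h3 := subproductCount_add_le hfree
    rw [Multiset.card_add, card_val, hA, mul_add]
    omega

/-- If `M` consists of `p - 1` terms outside `H` and `T` of terms in `H`, then every term of `T` counts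
`p` times: the subproducts of `M` meet `p` cosets of `H`. -/
theorem mul_card_add_card_le (p : ℕ) (hp : ∀ d, d ∣ Nat.card G → d ≠ 1 → p ≤ d)
    (H : Subgroup G) (M T : Multiset G) (hM : ∀ x ∈ M, x ∉ H) (hMc : M.card + 1 = p)
    (hT : ∀ x ∈ T, x ∈ H) (hfree : IsOneProductFree (M + T)) :
    p * T.card + M.card ≤ subproductCount (M + T) := by
  have h1 := min_mul_card_subproducts_le H p hp M T hM hT
  rw [hMc, min_self, card_subproducts, card_subproducts] at h1
  have h2 := Nat.mul_le_mul_left p (card_le_subproductCount (hfree.mono (Multiset.le_add_left T M)))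
  rw [mul_add] at h1
  omega

open Classical in
/-- With at least `p - 1` terms outside `H`, only the terms outside `H` are counted with weight less
than `p`. -/
theorem mul_card_le_of_le_card_filter (p : ℕ) (hp1 : 0 < p)
    (hp : ∀ d, d ∣ Nat.card G → d ≠ 1 → p ≤ d) (H : Subgroup G) (U : Multiset G)
    (hfree : IsOneProductFree U) (hout : p ≤ (U.filter (· ∉ H)).card + 1) :
    p * U.card ≤ subproductCount U + (p - 1) * (U.filter (· ∉ H)).card := by
  obtain ⟨M, hM⟩ : ∃ M, M ∈ Multiset.powersetCard (p - 1) (U.filter (· ∉ H)) := by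
    rw [← Multiset.card_pos_iff_exists_mem, Multiset.card_powersetCard]
    exact Nat.choose_pos (by omega)
  obtain ⟨hMle, hMc⟩ := Multiset.mem_powersetCard.1 hM
  have hU : (M + U.filter (· ∈ H)) + (U.filter (· ∉ H) - M) = U := by
    rw [add_right_comm, add_tsub_cancel_of_le hMle, add_comm, Multiset.filter_add_not]
  have hf := hfree
  rw [← hU] at hf
  have h1 := mul_card_add_card_le p hp H M (U.filter (· ∈ H))
    (fun x hx => (Multiset.mem_filter.1 (Multiset.mem_of_le hMle hx)).2) (by omega)
    (fun x hx => (Multiset.mem_filter.1 hx).2) (hf.mono (Multiset.le_add_right _ _))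
  have h2 := card_le_subproductCount (hf.mono (Multiset.le_add_left _ _))
  have h3 := subproductCount_add_le hf
  rw [hU] at h3
  rw [Multiset.card_sub hMle] at h2
  have h4 := Multiset.card_le_card hMle
  have h5 : U.card = (U.filter (· ∈ H)).card + (U.filter (· ∉ H)).card := by
    rw [← Multiset.card_add, Multiset.filter_add_not]
  obtain ⟨r, rfl⟩ : ∃ r, p = r + 1 := ⟨p - 1, by omega⟩
  rw [h5, mul_add, Nat.add_sub_cancel]
  rw [add_mul r 1 (U.filter (· ∉ H)).card]
  omega

open Classical in
/-- If `T` has fewer than `p - 1` terms outside `H`, sets from `L` are merged into `T` one at a time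
until there are at least `p - 1` of them. The overshoot is less than the size `k` of one set, while
the terms of the merged sets that lie in `H` still count `p` times. -/
theorem mul_card_le_of_card_filter_lt (p k : ℕ) (hp1 : 0 < p)
    (hp : ∀ d, d ∣ Nat.card G → d ≠ 1 → p ≤ d)
    (hk : ∀ A : Finset G, IsOneProductFree A.val → #A = k → p * k ≤ subproductCount A.val)
    (H : Subgroup G) (L : Multiset (Finset G)) (hL : ∀ A ∈ L, #A = k) (T : Multiset G)
    (hfree : IsOneProductFree ((L.map val).sum + T)) (hT : (T.filter (· ∉ H)).card + 1 < p)
    (hout : p ≤ (((L.map val).sum + T).filter (· ∉ H)).card + 1) :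
    p * ((L.map val).sum + T).card ≤
      subproductCount ((L.map val).sum + T) + (p - 1) * (k + p - 2) := by
  induction L using Multiset.induction_on generalizing T with
  | empty => simp at hout; omega
  | cons A L ih =>
    have hsum : ((A ::ₘ L).map val).sum + T = (L.map val).sum + (A.val + T) := by
      rw [Multiset.map_cons, Multiset.sum_cons, add_assoc, add_left_comm]
    rw [hsum] at hfree hout ⊢
    have hL' : ∀ B ∈ L, #B = k := fun B hB => hL B (Multiset.mem_cons_of_mem hB)
    by_cases hAT : p ≤ ((A.val + T).filter (· ∉ H)).card + 1
    · have h1 := mul_card_le_of_le_card_filter p hp1 hp H (A.val + T)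
        (hfree.mono (Multiset.le_add_left _ _)) hAT
      have h2 := mul_card_sum_le p k L hL' hk (hfree.mono (Multiset.le_add_right _ _))
      have h3 := subproductCount_add_le hfree
      have h4 : ((A.val + T).filter (· ∉ H)).card ≤ k + p - 2 := by
        rw [Multiset.filter_add, Multiset.card_add]
        have := Multiset.card_le_card (Multiset.filter_le (· ∉ H) A.val)
        rw [card_val, hL A (Multiset.mem_cons_self _ _)] at this
        omega
      have h5 := Nat.mul_le_mul_left (p - 1) h4
      rw [Multiset.card_add, mul_add]
      omega
    · exact ih hL' _ hfree (by omega) hout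

theorem sum_subproductCount_le {ι : Type*} (s : Finset ι) (f : ι → Multiset G)
    (hfree : IsOneProductFree (∑ i ∈ s, f i)) :
    ∑ i ∈ s, subproductCount (f i) ≤ subproductCount (∑ i ∈ s, f i) := by
  classical
  induction s using Finset.induction_on with
  | empty => simp
  | insert i s hi ih =>
    rw [sum_insert hi] at hfree ⊢
    rw [sum_insert hi]
    have h1 := ih (hfree.mono (Multiset.le_add_left _ _))
    have h2 := subproductCount_add_le hfree
    omega

open Classical in
/-- Unless the terms of multiplicity at least `p` lie in a common cyclic subgroup, all but at most
`p - 1` copies of each term of `T` count `p` times. Among the cyclic subgroups generated by such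
terms there are then at least two maximal ones; arranged in a cycle, each of them receives `p - 1`
copies of a generator of the next one, which lies outside it. -/
theorem mul_card_le_or_forall_mem (p : ℕ) (hp1 : 0 < p)
    (hp : ∀ d, d ∣ Nat.card G → d ≠ 1 → p ≤ d) (T : Multiset G) (hfree : IsOneProductFree T) :
    p * T.card ≤ subproductCount T + (p - 1) ^ 2 * #T.toFinset ∨
      ∃ g, ∀ x ∈ T, p ≤ T.count x → x ∈ Subgroup.zpowers g := by
  -- `M` consists of the maximal cyclic subgroups generated by a term of multiplicity at least `p`
  set R := T.toFinset.filter (fun x => p ≤ T.count x) with hR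
  set C := R.image Subgroup.zpowers with hC
  set M := C.filter (fun H => Maximal (· ∈ C) H) with hM
  have htop : ∀ x ∈ R, ∃ H ∈ M, x ∈ H := by
    intro x hx
    obtain ⟨H, hle, hH⟩ := C.finite_toSet.exists_le_maximal
      (mem_coe.2 (mem_image_of_mem Subgroup.zpowers hx))
    exact ⟨H, mem_filter.2 ⟨hH.1, hH⟩, hle (Subgroup.mem_zpowers x)⟩
  rcases M.eq_empty_or_nonempty with hM0 | ⟨H₀, hH₀⟩
  · right
    refine ⟨1, fun x hx hpx => ?_⟩
    obtain ⟨H, hH, -⟩ := htop x (mem_filter.2 ⟨Multiset.mem_toFinset.2 hx, hpx⟩)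
    rw [hM0] at hH
    simp at hH
  by_cases hMn : M.Nontrivial
  swap
  · right
    obtain ⟨g, -, hg⟩ := mem_image.1 (mem_filter.1 hH₀).1
    refine ⟨g, fun x hx hpx => ?_⟩
    obtain ⟨H, hH, hxH⟩ := htop x (mem_filter.2 ⟨Multiset.mem_toFinset.2 hx, hpx⟩)
    rw [hg]
    exact Set.not_nontrivial_iff.1 hMn hH hH₀ ▸ hxH
  left
  have hgen : ∀ H ∈ M, ∃ g ∈ R, Subgroup.zpowers g = H := fun H hH =>
    mem_image.1 (mem_filter.1 hH).1
  choose! gen hgenR hgen using hgen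
  choose! τ hτM hτ using htop
  have := Fintype.ofFinite (Subgroup G)
  obtain ⟨σ, hσ, -⟩ := M.exists_cycleOn
  have hσM : ∀ H ∈ M, σ H ∈ M := fun H hH => hσ.1.mapsTo hH
  have hnot : ∀ H ∈ M, gen (σ H) ∉ H := by
    intro H hH hmem
    have hle : σ H ≤ H := by
      rw [← hgen _ (hσM H hH)]
      exact Subgroup.zpowers_le.2 hmem
    exact hσ.apply_ne hMn hH
      (hle.antisymm ((mem_filter.1 (hσM H hH)).2.2 (mem_filter.1 hH).1 hle))
  -- `U H` collects the copies, beyond the first `p - 1`, of the terms assigned to `H`; `W H` adds to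
  -- it `p - 1` copies of the generator of the next subgroup in the cycle
  let e : G → ℕ := fun x => T.count x - (p - 1)
  let U : Subgroup G → Multiset G := fun H => ∑ x ∈ R with τ x = H, Multiset.replicate (e x) x
  have hU : ∀ H, ∀ x ∈ U H, x ∈ R ∧ τ x = H := by
    intro H x hx
    obtain ⟨y, hy, hxy⟩ := Multiset.mem_sum.1 hx
    rw [Multiset.eq_of_mem_replicate hxy]
    exact mem_filter.1 hy
  have hUsum : ∑ H ∈ M, U H = ∑ x ∈ R, Multiset.replicate (e x) x :=
    sum_fiberwise_of_maps_to hτM _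
  have hcountU : ∀ x, (∑ y ∈ R, Multiset.replicate (e y) y).count x = if x ∈ R then e x else 0 := by
    intro x
    rw [Multiset.count_sum']
    simp [Multiset.count_replicate]
  have hcountV : ∀ x, (∑ H ∈ M, Multiset.replicate (p - 1) (gen (σ H))).count x ≤
      if x ∈ R then p - 1 else 0 := by
    intro x
    rw [Multiset.count_sum']
    simp only [Multiset.count_replicate]
    rw [← sum_filter, sum_const, smul_eq_mul]
    split_ifs with hx
    · have : #{H ∈ M | gen (σ H) = x} ≤ 1 := by
        rw [card_le_one]
        intro H hH K hK
        obtain ⟨hHM, hHx⟩ := mem_filter.1 hH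
        obtain ⟨hKM, hKx⟩ := mem_filter.1 hK
        apply σ.injective
        rw [← hgen _ (hσM H hHM), ← hgen _ (hσM K hKM), hHx, hKx]
      calc _ ≤ 1 * (p - 1) := Nat.mul_le_mul_right _ this
        _ = _ := one_mul _
    · rw [filter_eq_empty_iff.2, card_empty, zero_mul]
      rintro H hH rfl
      exact hx (hgenR _ (hσM H hH))
  let W : Subgroup G → Multiset G := fun H => Multiset.replicate (p - 1) (gen (σ H)) + U H
  have hWsum : ∑ H ∈ M, W H = (∑ H ∈ M, Multiset.replicate (p - 1) (gen (σ H))) +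
      ∑ x ∈ R, Multiset.replicate (e x) x := by rw [sum_add_distrib, hUsum]
  have hWT : ∑ H ∈ M, W H ≤ T := by
    rw [Multiset.le_iff_count]
    intro x
    rw [hWsum, Multiset.count_add, hcountU]
    have h1 := hcountV x
    split_ifs at h1 ⊢ with hx
    · have := (mem_filter.1 hx).2
      simp only [e]
      omega
    · omega
  have hWfree := hfree.mono hWT
  have hW : ∀ H ∈ M, p * (U H).card + (p - 1) ≤ subproductCount (W H) := by
    intro H hH
    have h := mul_card_add_card_le p hp H (Multiset.replicate (p - 1) (gen (σ H))) (U H)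
      (fun x hx => by rw [Multiset.eq_of_mem_replicate hx]; exact hnot H hH)
      (by rw [Multiset.card_replicate]; omega)
      (fun x hx => by
        obtain ⟨hxR, hxH⟩ := hU H x hx
        exact hxH ▸ hτ x hxR)
      (hWfree.mono (single_le_sum_of_canonicallyOrdered (f := W) hH))
    rwa [Multiset.card_replicate] at h
  have h1 := (sum_le_sum hW).trans (sum_subproductCount_le M W hWfree)
  have hcardU : ∑ H ∈ M, (U H).card = ∑ x ∈ R, e x := by
    rw [← Multiset.card_sum, hUsum, Multiset.card_sum]
    simp
  have hcardW : (∑ H ∈ M, W H).card = #M * (p - 1) + ∑ x ∈ R, e x := by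
    rw [hWsum, Multiset.card_add, Multiset.card_sum, Multiset.card_sum]
    simp
  rw [sum_add_distrib, ← mul_sum, hcardU, sum_const, smul_eq_mul] at h1
  have hTW : (∑ H ∈ M, W H) + (T - ∑ H ∈ M, W H) = T := add_tsub_cancel_of_le hWT
  have h2 := subproductCount_add_le (hTW.symm ▸ hfree)
  rw [hTW] at h2
  have h3 := card_le_subproductCount (hfree.mono (tsub_le_self : T - ∑ H ∈ M, W H ≤ T))
  rw [Multiset.card_sub hWT, hcardW] at h3
  have h4 := Multiset.card_le_card hWT
  rw [hcardW] at h4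
  have h5 : T.card ≤ #T.toFinset * (p - 1) + ∑ x ∈ R, e x := by
    rw [← Multiset.toFinset_sum_count_eq T, hR, sum_filter, ← smul_eq_mul, ← sum_const,
      ← sum_add_distrib]
    refine sum_le_sum fun x _ => ?_
    split_ifs with hx
    · simp only [e]; omega
    · omega
  obtain ⟨r, rfl⟩ : ∃ r, p = r + 1 := ⟨p - 1, by omega⟩
  rw [Nat.add_sub_cancel] at h1 h3 h4 h5 ⊢
  have h6 : T.card + r * ∑ x ∈ R, e x ≤ subproductCount T := by
    rw [add_mul, one_mul] at h1
    omega
  nlinarith [Nat.mul_le_mul_left r h5]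

/-- The bound `|S| ≤ n / p + 9p² - 10p`, multiplied by `p`, for a single one-product free sequence. -/
theorem mul_card_add_le (hG : ¬ IsCyclic G) (p : ℕ) (hp2 : 2 ≤ p)
    (hp : ∀ d, d ∣ Nat.card G → d ≠ 1 → p ≤ d) (S : Multiset G) (hfree : IsOneProductFree S) :
    p * S.card + 10 * p ^ 2 ≤ Nat.card G + 9 * p ^ 3 := by
  classical
  obtain ⟨k, hk0, hk1, hk2, hk⟩ := exists_set_size (G := G) p hp2 hp
  obtain ⟨L, T, rfl, hL, hT⟩ := exists_finsets_add_eq k hk0 S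
  have hlt : subproductCount ((L.map val).sum + T) < Nat.card G := by
    simpa using subproductCount_lt_card (K := (⊤ : Subgroup G)) (S := (L.map val).sum + T) (by simp)
  have hLc := mul_card_sum_le p k L hL hk (hfree.mono (Multiset.le_add_right _ _))
  have hadd := subproductCount_add_le hfree
  have hgood : p * T.card ≤ subproductCount T + (p - 1) ^ 2 * #T.toFinset →
      p * ((L.map val).sum + T).card + 10 * p ^ 2 ≤ Nat.card G + 9 * p ^ 3 := by
    intro h
    have := Nat.mul_le_mul_left ((p - 1) ^ 2) (show #T.toFinset ≤ k - 1 by omega)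
    rw [Multiset.card_add, mul_add]
    omega
  rcases mul_card_le_or_forall_mem p (by omega) hp T (hfree.mono (Multiset.le_add_left _ _))
    with h | ⟨g, hg⟩
  · exact hgood h
  set H := Subgroup.zpowers g with hH
  set S := (L.map val).sum + T with hS
  by_cases hout : p ≤ (S.filter (· ∉ H)).card + 1
  · by_cases houtT : p ≤ (T.filter (· ∉ H)).card + 1
    · apply hgood
      have h1 := mul_card_le_of_le_card_filter p (by omega) hp H T
        (hfree.mono (Multiset.le_add_left _ _)) houtT
      have h2 : (T.filter (· ∉ H)).card ≤ (p - 1) * #T.toFinset := by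
        rw [← Multiset.toFinset_sum_count_eq, mul_comm, ← smul_eq_mul, ← sum_const]
        refine (sum_le_sum fun x hx => ?_).trans
          (sum_le_sum_of_subset (Multiset.toFinset_subset.2
            (Multiset.subset_of_le (Multiset.filter_le (· ∉ H) T))))
        obtain ⟨hxT, hxH⟩ := Multiset.mem_filter.1 (Multiset.mem_toFinset.1 hx)
        refine (Multiset.count_le_of_le x (Multiset.filter_le _ T)).trans ?_
        by_contra! hlt'
        exact hxH (hg x hxT (by omega))
      have h3 := Nat.mul_le_mul_left (p - 1) h2
      rw [← mul_assoc, ← sq] at h3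
      omega
    · have := mul_card_le_of_card_filter_lt p k (by omega) hp hk H L hL T hfree (by omega) hout
      rw [← hS] at this
      omega
  · -- almost all terms lie in the proper subgroup `H`, whose index is at least `p`
    have hHtop : H.index ≠ 1 := by
      intro h
      exact hG (isCyclic_iff_exists_zpowers_eq_top.2 ⟨g, Subgroup.index_eq_one.1 h⟩)
    have h1 := hp _ (Subgroup.index_dvd_card H) hHtop
    have h2 := Subgroup.card_mul_index H
    have h3 := subproductCount_lt_card (K := H) (S := S.filter (· ∈ H))
      (fun x hx => (Multiset.mem_filter.1 hx).2)
    have h4 := card_le_subproductCount (hfree.mono (Multiset.filter_le (· ∈ H) S))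
    have h5 : S.card = (S.filter (· ∈ H)).card + (S.filter (· ∉ H)).card := by
      rw [← Multiset.card_add, Multiset.filter_add_not]
    have h6 : Nat.card H * p ≤ Nat.card G := by
      rw [← h2]; exact Nat.mul_le_mul_left _ h1
    have h7 : S.card + 3 ≤ Nat.card H + p := by omega
    have h8 := Nat.mul_le_mul_left p h7
    nlinarith [Nat.mul_le_mul hp2 hp2, Nat.mul_le_mul_left (p ^ 2) hp2]

end Main

/-! ### The small Davenport constant -/

theorem theorem1 {G : Type*} [Group G] [Finite G] (hG : ¬ IsCyclic G)
    (n : ℕ) (hn : Nat.card G = n)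
    (p : ℕ) (hp : IsLeast {q : ℕ | q.Prime ∧ q ∣ n} p) :
    ∃ d : ℕ, smallDavenport G = (d : ℕ∞) ∧
      (d : ℝ) ≤ (n : ℝ) / (p : ℝ) + 9 * (p : ℝ) ^ 2 - 10 * (p : ℝ) := by
  obtain ⟨⟨hpp, hpn⟩, hpmin⟩ := hp
  have hdiv : ∀ d, d ∣ Nat.card G → d ≠ 1 → p ≤ d := fun d hd hd1 =>
    (hpmin ⟨Nat.minFac_prime hd1, (Nat.minFac_dvd d).trans (hn ▸ hd)⟩).trans
      (Nat.minFac_le (Nat.pos_of_dvd_of_pos hd Nat.card_pos))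
  have hp0 : (0 : ℝ) < p := by exact_mod_cast hpp.pos
  have hbound : ∀ S : {S : Multiset G // IsOneProductFree S},
      ((S : Multiset G).card : ℝ) ≤ (n : ℝ) / p + 9 * (p : ℝ) ^ 2 - 10 * p := by
    rintro ⟨S, hS⟩
    have h : (p * S.card + 10 * p ^ 2 : ℝ) ≤ n + 9 * p ^ 3 := by
      exact_mod_cast hn ▸ mul_card_add_le hG p hpp.two_le hdiv S hS
    have h' : ((S.card : ℝ) + 10 * p - 9 * p ^ 2) ≤ n / p := by
      rw [le_div_iff₀ hp0]
      linarith
    simp only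
    linarith
  -- the supremum of a nonempty bounded family of natural numbers is attained
  have : Nonempty {S : Multiset G // IsOneProductFree S} :=
    ⟨0, fun ⟨T, hT, hT0, _⟩ => hT0 (Multiset.le_zero.1 hT)⟩
  have hbdd : BddAbove (Set.range fun S : {S : Multiset G // IsOneProductFree S} =>
      (S : Multiset G).card) := by
    refine ⟨⌊(n : ℝ) / p + 9 * (p : ℝ) ^ 2 - 10 * p⌋₊, ?_⟩
    rintro _ ⟨S, rfl⟩
    exact Nat.le_floor (hbound S)
  obtain ⟨S, hS⟩ := Nat.sSup_mem (Set.range_nonempty _) hbdd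
  refine ⟨(S : Multiset G).card, le_antisymm (iSup_le fun U => ?_) (le_iSup_of_le S le_rfl),
    hbound S⟩
  have : (U : Multiset G).card ≤ (S : Multiset G).card := by
    simp only at hS
    rw [hS]
    exact le_csSup hbdd ⟨U, rfl⟩
  exact_mod_cast this
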